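/- Let $M\ge 1$, $1>\rho_1>\rho_2>\dots>\rho_M>0$, $q_1=1$, $q_j>0$ ($j=2,\dots,M$), let $0<\lambda_1\le\lambda_2\le\cdots\to\infty$ (in the application, the eigenvalues of a positive self-adjoint elliptic operator), let $T>0$, and let $g\in C^1[0,T]$ be real-valued with $g(0)\neq 0$ ($g$ may change sign). With the multinomial Mittag-Leffler function $$E_{(\beta_1,\dots,\beta_M),\beta_0}(z_1,\dots,z_M)=\sum_{k=0}^\infty\ \sum_{k_1+\dots+k_M=k}\frac{k!}{k_1!\cdots k_M!}\,\frac{\prod_{j=1}^M z_j^{k_j}}{\Gamma\bigl(\beta_0+\sum_{j=1}^M\beta_jk_j\bigr)}$$ and $\rho'=(\rho_1,\rho_1-\rho_2,\dots,\rho_1-\rho_M)$, put for $k\ge 1$ and $0<t_0\le T$ $$b_{k,\rho_1}(t_0)=\int_0^{t_0} g(t_0-\xi)\,\xi^{\rho_1-1}E_{\rho',\rho_1}\bigl(-\lambda_k\xi^{\rho_1},-q_2\xi^{\rho_1-\rho_2},\dots,-q_M\xi^{\rho_1-\rho_M}\bigr)\,d\xi .$$ Let $K_{0,\rho_1}$ (respectively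 $K_{\rho_1}$) be the set of indices $k$ with $b_{k,\rho_1}(t_0)=0$ (respectively $\neq 0$). Consider the two-sided estimate $$\frac{\widetilde C_0}{\lambda_k}\le |b_{k,\rho_1}(t_0)|\le\frac{\widetilde C_1}{\lambda_k}.\tag{$*$}$$ Then there are $r_0\in(0,T]$ and a constant $\widetilde C_1>0$, not depending on $t_0$ and $k$, such that the following hold. 1. There is $k_0$ such that for every $t_0\in(0,r_0]$ there is $\widetilde C_0>0$ (not depending on $k$, but possibly depending on $t_0$) for which $(*)$ holds for all $k\ge k_0$. Moreover, there is $\widetilde C_0>0$ not depending on $t_0$ and $k$ such that for every $t_0\in(0,r_0]$ there is $k_0$ (possibly depending on $t_0$) for which $(*)$ holds for all $k\ge k_0$. 2. For every $t_0\in(0,r_0]$ there is $\widetilde C_0>0$ (not depending on $k$) such that $(*)$ holds for all $k\in K_{\rho_1}$. 3. For every $t_0\in(0,r_0]$ the set $K_{0,\rho_1}$ is finite. -/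

import Mathlib

/-- The multinomial Mittag-Leffler function `E_{(β₁,…,β_M),β₀}(z₁,…,z_M)` at real arguments:
the sum over `k = 0, 1, 2, …` of the finite sums over all `κ = (k₁,…,k_M)` with
`k₁ + ⋯ + k_M = k`. -/
noncomputable def multinomialMittagLeffler {M : ℕ} (β : Fin M → ℝ) (β₀ : ℝ) (z : Fin M → ℝ) : ℝ :=
  ∑' k : ℕ, ∑ κ ∈ Finset.piAntidiag (Finset.univ : Finset (Fin M)) k,
    (Nat.multinomial Finset.univ κ : ℝ) * (∏ j, z j ^ κ j) / Real.Gamma (β₀ + ∑ j, β j * (κ j : ℝ))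

/-- The vector `ρ' = (ρ₁, ρ₁ - ρ₂, …, ρ₁ - ρ_M)`, with `M = m + 1` and `ρ₁ = ρ 0`. -/
def rhoPrime {m : ℕ} (ρ : Fin (m + 1) → ℝ) : Fin (m + 1) → ℝ :=
  Fin.cons (ρ 0) (fun j : Fin m => ρ 0 - ρ j.succ)

/-- `E_{ρ',β₀}(-l t^{ρ₁}, *)
  = E_{ρ',β₀}(-l t^{ρ₁}, -q₂ t^{ρ₁ - ρ₂}, …, -q_M t^{ρ₁ - ρ_M})`. -/
noncomputable def mittagLefflerAt {m : ℕ} (ρ q : Fin (m + 1) → ℝ) (β₀ l t : ℝ) : ℝ :=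
  multinomialMittagLeffler (rhoPrime ρ) β₀
    (Fin.cons (-l * t ^ ρ 0) (fun j : Fin m => -q j.succ * t ^ (ρ 0 - ρ j.succ)))

/-- `b_{k,ρ₁}(t₀) = ∫₀^{t₀} g(t₀ - ξ) ξ^{ρ₁ - 1} E_{ρ',ρ₁}(-λ_k ξ^{ρ₁}, *) dξ`, where `lam k` is
`λ_k`. -/
noncomputable def bCoeff {m : ℕ} (ρ q : Fin (m + 1) → ℝ) (lam : ℕ → ℝ) (g : ℝ → ℝ)
    (k : ℕ) (t₀ : ℝ) : ℝ :=
  ∫ ξ in (0 : ℝ)..t₀, g (t₀ - ξ) * ξ ^ (ρ 0 - 1) * mittagLefflerAt ρ q (ρ 0) (lam k) ξ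

/-- The set `K_{0,ρ₁}` of indices `k` with `b_{k,ρ₁}(t₀) = 0`. -/
def KZero {m : ℕ} (ρ q : Fin (m + 1) → ℝ) (lam : ℕ → ℝ) (g : ℝ → ℝ) (t₀ : ℝ) : Set ℕ :=
  {k | bCoeff ρ q lam g k t₀ = 0}

/-- The set `K_{ρ₁}` of indices `k` with `b_{k,ρ₁}(t₀) ≠ 0`. -/
def KNonzero {m : ℕ} (ρ q : Fin (m + 1) → ℝ) (lam : ℕ → ℝ) (g : ℝ → ℝ) (t₀ : ℝ) : Set ℕ :=
  {k | bCoeff ρ q lam g k t₀ ≠ 0}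

open MeasureTheory

/-! Write `r` for ρ₁, `k_a(t) = t^(a-1)/Γ(a)`, and `u` for the kernel in `b_k` with `l = λ_k`. The
multinomial recurrence and the Beta integral give the Volterra equation `u = k_r - ∑ d_j (k_{β_j} *
u)` with `β = ρ'` and `d = (l, q₂, …, q_M)`.

The crux is `u > 0` (`mittagLefflerKernel_pos`), by comparing this equation at two nearby times.
Since `k_r` decreases, positivity gives `l ∫₀ᵗ u ≤ 1`. In the integrated equation the kernels
`k_{β_j+1}` increase, whence `l ∫₀ᵗ u ≥ lK/(A + lK)` with `A, K > 0` depending on `t` but not on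
`l`. This is bounded below for `l ≥ λ₁` and tends to 1 as `l → ∞`.

Take `r₀` so small that `g` keeps its sign on `[0, r₀]` and `|g|` lies between `|g(0)|/2` and
`2|g(0)|`. Then `|b_k|` is comparable to `∫₀ᵗ u`, hence to `1/λ_k`. In fact no `b_k` vanishes for
such `t₀`, so the estimate holds from the first index on. -/

theorem exp_neg_mul_rpow_le_Gamma {x R : ℝ} (hx : 0 < x) (hR : 1 ≤ R) :
    Real.exp (-R) * R ^ (x - 1) ≤ Real.Gamma x := by
  -- For `y ≥ 1` the factor `s ^ (y - 1)` increases, so the part `s ≥ R` of the Gamma integral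
  -- suffices.
  have key : ∀ y : ℝ, 1 ≤ y → Real.exp (-R) * R ^ (y - 1) ≤ Real.Gamma y := by
    intro y hy
    have hR0 : 0 < R := by linarith
    rw [Real.Gamma_eq_integral (by linarith)]
    have hint := Real.GammaIntegral_convergent (s := y) (by linarith)
    have hsub : Set.Ioi R ⊆ Set.Ioi 0 := Set.Ioi_subset_Ioi hR0.le
    calc Real.exp (-R) * R ^ (y - 1) = ∫ s in Set.Ioi R, Real.exp (-s) * R ^ (y - 1) := by
          rw [integral_mul_const, integral_exp_neg_Ioi]
      _ ≤ ∫ s in Set.Ioi R, Real.exp (-s) * s ^ (y - 1) := by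
          refine setIntegral_mono_on ((integrableOn_exp_neg_Ioi R).mul_const _)
            (hint.mono_set hsub) measurableSet_Ioi fun s hs => ?_
          have : R ≤ s := le_of_lt hs
          gcongr
      _ ≤ ∫ s in Set.Ioi 0, Real.exp (-s) * s ^ (y - 1) := by
          refine setIntegral_mono_set hint ?_ hsub.eventuallyLE
          filter_upwards [ae_restrict_mem measurableSet_Ioi] with s hs
          have : 0 < s := hs
          positivity
  have hR0 : 0 < R := by linarith
  rcases le_or_gt 1 x with h | h
  · exact key x h
  · have h1 := key (x + 1) (by linarith)
    rw [Real.Gamma_add_one hx.ne', add_sub_cancel_right] at h1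
    have h2 : R ^ (x - 1) ≤ R ^ x := Real.rpow_le_rpow_of_exponent_le hR (by linarith)
    have h3 := Real.Gamma_pos_of_pos hx
    calc Real.exp (-R) * R ^ (x - 1) ≤ Real.exp (-R) * R ^ x := by gcongr
      _ ≤ x * Real.Gamma x := h1
      _ ≤ Real.Gamma x := by nlinarith

/-! ### Riemann-Liouville kernels and their convolutions -/

/-- The kernel `t ^ (a - 1) / Γ(a)` of the Riemann-Liouville fractional integral of order `a`. -/
noncomputable def fracKernel (a t : ℝ) : ℝ := t ^ (a - 1) / Real.Gamma a

theorem fracKernel_pos {a t : ℝ} (ha : 0 < a) (ht : 0 < t) : 0 < fracKernel a t :=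
  div_pos (Real.rpow_pos_of_pos ht _) (Real.Gamma_pos_of_pos ha)

theorem fracKernel_nonneg {a t : ℝ} (ha : 0 < a) (ht : 0 ≤ t) : 0 ≤ fracKernel a t :=
  div_nonneg (Real.rpow_nonneg ht _) (Real.Gamma_pos_of_pos ha).le

/-- There is a singularity at each end: split at `t / 2` and reflect one half onto the other. -/
theorem intervalIntegrable_fracKernel_sub_mul_rpow {a b t : ℝ} (ha : 0 < a) (hb : 0 < b)
    (ht : 0 < t) :
    IntervalIntegrable (fun s => fracKernel a (t - s) * s ^ (b - 1)) volume 0 t := by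
  have hl : ∀ u v : ℝ, 0 < u → IntervalIntegrable
      (fun s : ℝ => (t - s) ^ (v - 1) * s ^ (u - 1)) volume 0 (t / 2) := by
    intro u v hu
    refine IntervalIntegrable.continuousOn_mul
      (intervalIntegral.intervalIntegrable_rpow' (by linarith)) ?_
    refine ContinuousOn.rpow_const (by fun_prop) fun s hs => Or.inl ?_
    rw [Set.uIcc_of_le (by linarith)] at hs
    have := hs.2
    linarith
  have hr := (hl a b ha).comp_sub_left t
  rw [sub_zero, sub_half] at hr
  have h := (hl b a hb).trans (hr.symm.congr (g := fun s : ℝ => (t - s) ^ (a - 1) * s ^ (b - 1))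
    (fun s _ => by simp only [sub_sub_cancel]; ring))
  refine (h.div_const (Real.Gamma a)).congr fun s _ => ?_
  simp only [fracKernel]; ring

theorem integral_fracKernel_sub_mul_rpow {a b t : ℝ} (ha : 0 < a) (hb : 0 < b) (ht : 0 < t) :
    ∫ s in (0 : ℝ)..t, fracKernel a (t - s) * s ^ (b - 1) =
      Real.Gamma b * fracKernel (b + a) t := by
  have h : (((∫ s in (0 : ℝ)..t, s ^ (b - 1) * (t - s) ^ (a - 1)) : ℝ) : ℂ) =
      ((t ^ (b + a - 1) * (Real.Gamma b * Real.Gamma a / Real.Gamma (b + a)) : ℝ) : ℂ) := by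
    have h1 := Complex.betaIntegral_scaled b a ht
    rw [Complex.betaIntegral_eq_Gamma_mul_div _ _ (by simpa) (by simpa)] at h1
    rw [← intervalIntegral.integral_ofReal]
    push_cast
    rw [Complex.ofReal_cpow ht.le, ← Complex.Gamma_ofReal, ← Complex.Gamma_ofReal,
      ← Complex.Gamma_ofReal]
    push_cast
    rw [← h1]
    refine intervalIntegral.integral_congr fun s hs => ?_
    rw [Set.uIcc_of_le ht.le] at hs
    rw [Complex.ofReal_cpow hs.1, Complex.ofReal_cpow (by linarith [hs.2])]
    push_cast
    rfl
  have h' := Complex.ofReal_injective h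
  have hΓ := (Real.Gamma_pos_of_pos ha).ne'
  calc ∫ s in (0 : ℝ)..t, fracKernel a (t - s) * s ^ (b - 1)
      = ∫ s in (0 : ℝ)..t, (s ^ (b - 1) * (t - s) ^ (a - 1)) / Real.Gamma a := by
        congr 1; ext s; simp only [fracKernel]; ring
    _ = _ := by
        rw [intervalIntegral.integral_div, h', fracKernel]
        field_simp

/-! ### The multinomial series: recurrence, convergence, continuity -/

section Series

variable {n : ℕ}

/-- The homogeneous part of degree `k` of the multinomial Mittag-Leffler series. -/
noncomputable def mittagLefflerTerm (β : Fin n → ℝ) (γ : ℝ) (z : Fin n → ℝ) (k : ℕ) : ℝ :=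
  ∑ κ ∈ Finset.piAntidiag (Finset.univ : Finset (Fin n)) k,
    (Nat.multinomial Finset.univ κ : ℝ) * (∏ j, z j ^ κ j) / Real.Gamma (γ + ∑ j, β j * (κ j : ℝ))

theorem mittagLefflerTerm_zero (β : Fin n → ℝ) (γ : ℝ) (z : Fin n → ℝ) :
    mittagLefflerTerm β γ z 0 = 1 / Real.Gamma γ := by
  simp [mittagLefflerTerm, Nat.multinomial]

/-- The linear functional on polynomials sending the monomial `X ^ κ` to
`1 / Γ(γ + ∑ j, β j * κ j)`. -/
noncomputable def invGammaFunctional (β : Fin n → ℝ) (γ : ℝ) : MvPolynomial (Fin n) ℝ →ₗ[ℝ] ℝ :=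
  (MvPolynomial.basisMonomials (Fin n) ℝ).constr ℝ
    fun κ => (Real.Gamma (γ + ∑ j, β j * (κ j : ℝ)))⁻¹

theorem invGammaFunctional_monomial (β : Fin n → ℝ) (γ : ℝ) (κ : Fin n →₀ ℕ) (r : ℝ) :
    invGammaFunctional β γ (MvPolynomial.monomial κ r) =
      r * (Real.Gamma (γ + ∑ j, β j * (κ j : ℝ)))⁻¹ := by
  have h : MvPolynomial.monomial κ r = r • MvPolynomial.basisMonomials (Fin n) ℝ κ := by
    simp [MvPolynomial.smul_monomial]
  rw [h, map_smul, invGammaFunctional, Module.Basis.constr_basis, smul_eq_mul]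

theorem invGammaFunctional_X_mul (β : Fin n → ℝ) (γ : ℝ) (j : Fin n) (p : MvPolynomial (Fin n) ℝ) :
    invGammaFunctional β γ (MvPolynomial.X j * p) = invGammaFunctional β (γ + β j) p := by
  induction p using MvPolynomial.induction_on' with
  | monomial κ r =>
    rw [MvPolynomial.X, MvPolynomial.monomial_mul, invGammaFunctional_monomial,
      invGammaFunctional_monomial, one_mul]
    congr 3
    simp [Finsupp.single_apply, mul_add, Finset.sum_add_distrib, add_assoc]
  | add p q hp hq => rw [mul_add, map_add, map_add, hp, hq]

theorem mittagLefflerTerm_eq_invGammaFunctional (β : Fin n → ℝ) (γ : ℝ) (z : Fin n → ℝ) (k : ℕ) :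
    mittagLefflerTerm β γ z k =
      invGammaFunctional β γ ((∑ j, MvPolynomial.C (z j) * MvPolynomial.X j) ^ k) := by
  rw [Finset.sum_pow_eq_sum_piAntidiag, map_sum, mittagLefflerTerm]
  refine Finset.sum_congr rfl fun κ _ => ?_
  have h : (Nat.multinomial Finset.univ κ : MvPolynomial (Fin n) ℝ) *
      ∏ j, (MvPolynomial.C (z j) * MvPolynomial.X j) ^ κ j =
      MvPolynomial.monomial (Finsupp.equivFunOnFinite.symm κ)
        ((Nat.multinomial Finset.univ κ : ℝ) * ∏ j, z j ^ κ j) := by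
    rw [MvPolynomial.monomial_eq, Finsupp.prod_fintype _ _ (by simp)]
    simp [mul_pow, Finset.prod_mul_distrib, mul_assoc]
  rw [h, invGammaFunctional_monomial, div_eq_mul_inv]
  rfl

/-- Each term is a linear functional of a power of `∑ z_j X_j`. Splitting off one factor replaces
Pascal's rule for multinomial coefficients, and each `X_j` shifts `γ` by `β_j`. -/
theorem mittagLefflerTerm_succ (β : Fin n → ℝ) (γ : ℝ) (z : Fin n → ℝ) (k : ℕ) :
    mittagLefflerTerm β γ z (k + 1) = ∑ j, z j * mittagLefflerTerm β (γ + β j) z k := by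
  simp only [mittagLefflerTerm_eq_invGammaFunctional]
  rw [pow_succ', Finset.sum_mul, map_sum]
  refine Finset.sum_congr rfl fun j _ => ?_
  rw [mul_assoc, MvPolynomial.C_mul', map_smul, invGammaFunctional_X_mul, smul_eq_mul]

/-- The bound `Γ(x) ≥ e^(-R) R^(x-1)` is multiplicative in `κ`, so the multinomial theorem resums
it. The free parameter `R` later makes the ratio at most 1/2. -/
theorem abs_mittagLefflerTerm_le {β : Fin n → ℝ} (hβ : ∀ j, 0 ≤ β j) {γ : ℝ} (hγ : 0 < γ)
    (z : Fin n → ℝ) {R : ℝ} (hR : 1 ≤ R) (k : ℕ) :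
    |mittagLefflerTerm β γ z k| ≤
      Real.exp R * R ^ (1 - γ) * (∑ j, |z j| * R ^ (-β j)) ^ k := by
  have hR0 : 0 < R := by linarith
  rw [Finset.sum_pow_eq_sum_piAntidiag, Finset.mul_sum]
  refine (Finset.abs_sum_le_sum_abs _ _).trans (Finset.sum_le_sum fun κ _ => ?_)
  have hs : 0 ≤ ∑ j, β j * (κ j : ℝ) := Finset.sum_nonneg fun j _ => mul_nonneg (hβ j) (by simp)
  have hpos : 0 < γ + ∑ j, β j * (κ j : ℝ) := by linarith
  have hΓ := exp_neg_mul_rpow_le_Gamma hpos hR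
  have hΓ' : (Real.Gamma (γ + ∑ j, β j * (κ j : ℝ)))⁻¹ ≤
      Real.exp R * R ^ (1 - γ) * ∏ j, (R ^ (-β j)) ^ κ j := by
    refine (inv_anti₀ (by positivity) hΓ).trans (le_of_eq ?_)
    rw [mul_inv, ← Real.exp_neg, neg_neg, ← Real.rpow_neg hR0.le, mul_assoc]
    congr 1
    simp_rw [← Real.rpow_natCast, ← Real.rpow_mul hR0.le]
    rw [← Real.rpow_sum_of_pos hR0, ← Real.rpow_add hR0]
    congr 1
    simp only [neg_mul, Finset.sum_neg_distrib]
    ring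
  rw [abs_div, abs_mul, Nat.abs_cast, Finset.abs_prod, abs_of_pos (Real.Gamma_pos_of_pos hpos),
    div_eq_mul_inv]
  simp_rw [abs_pow, mul_pow]
  rw [Finset.prod_mul_distrib]
  calc (Nat.multinomial Finset.univ κ : ℝ) * (∏ j, |z j| ^ κ j) *
        (Real.Gamma (γ + ∑ j, β j * (κ j : ℝ)))⁻¹
      ≤ (Nat.multinomial Finset.univ κ : ℝ) * (∏ j, |z j| ^ κ j) *
        (Real.exp R * R ^ (1 - γ) * ∏ j, (R ^ (-β j)) ^ κ j) := by gcongr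
    _ = _ := by ring

theorem exists_sum_mul_rpow_neg_le_half {β : Fin n → ℝ} (hβ : ∀ j, 0 < β j) (z : Fin n → ℝ) :
    ∃ R : ℝ, 1 ≤ R ∧ ∑ j, |z j| * R ^ (-β j) ≤ 1 / 2 := by
  have h : Filter.Tendsto (fun R : ℝ => ∑ j, |z j| * R ^ (-β j)) Filter.atTop (nhds 0) := by
    have := tendsto_finsetSum (Finset.univ : Finset (Fin n)) fun j _ =>
      (tendsto_rpow_neg_atTop (hβ j)).const_mul |z j|
    simpa using this
  obtain ⟨R, h1, h2⟩ := ((Filter.eventually_ge_atTop (1 : ℝ)).and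
    (h.eventually_le_const (by norm_num : (0 : ℝ) < 1 / 2))).exists
  exact ⟨R, h1, h2⟩

/-- On bounded boxes the Mittag-Leffler series is dominated by a geometric series. -/
theorem exists_abs_mittagLefflerTerm_le {β : Fin n → ℝ} (hβ : ∀ j, 0 < β j) {γ : ℝ} (hγ : 0 < γ)
    (w : Fin n → ℝ) :
    ∃ C : ℝ, 0 ≤ C ∧ ∀ z : Fin n → ℝ, (∀ j, |z j| ≤ |w j|) → ∀ k,
      |mittagLefflerTerm β γ z k| ≤ C * (1 / 2) ^ k := by
  obtain ⟨R, hR, hw⟩ := exists_sum_mul_rpow_neg_le_half hβ w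
  have hR0 : 0 < R := by linarith
  refine ⟨Real.exp R * R ^ (1 - γ), by positivity, fun z hz k => ?_⟩
  refine (abs_mittagLefflerTerm_le (fun j => (hβ j).le) hγ z hR k).trans ?_
  gcongr
  exact (Finset.sum_le_sum fun j _ =>
    mul_le_mul_of_nonneg_right (hz j) (Real.rpow_nonneg hR0.le _)).trans hw

theorem summable_mittagLefflerTerm {β : Fin n → ℝ} (hβ : ∀ j, 0 < β j) {γ : ℝ} (hγ : 0 < γ)
    (z : Fin n → ℝ) : Summable (mittagLefflerTerm β γ z) := by
  obtain ⟨C, -, h⟩ := exists_abs_mittagLefflerTerm_le hβ hγ z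
  exact Summable.of_norm_bounded (summable_geometric_two.mul_left C) fun k => h z (fun _ => le_rfl) k

theorem hasSum_mittagLefflerTerm {β : Fin n → ℝ} (hβ : ∀ j, 0 < β j) {γ : ℝ} (hγ : 0 < γ)
    (z : Fin n → ℝ) :
    HasSum (mittagLefflerTerm β γ z) (multinomialMittagLeffler β γ z) :=
  (summable_mittagLefflerTerm hβ hγ z).hasSum

theorem multinomialMittagLeffler_eq_add_sum {β : Fin n → ℝ} (hβ : ∀ j, 0 < β j) {γ : ℝ}
    (hγ : 0 < γ) (z : Fin n → ℝ) :
    multinomialMittagLeffler β γ z =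
      1 / Real.Gamma γ + ∑ j, z j * multinomialMittagLeffler β (γ + β j) z := by
  have h0 := (hasSum_mittagLefflerTerm hβ hγ z).tsum_eq
  rw [(summable_mittagLefflerTerm hβ hγ z).tsum_eq_zero_add, mittagLefflerTerm_zero] at h0
  rw [← h0]
  congr 1
  simp_rw [mittagLefflerTerm_succ]
  exact (hasSum_sum fun j _ =>
    (hasSum_mittagLefflerTerm hβ (add_pos hγ (hβ j)) z).mul_left (z j)).tsum_eq

theorem continuousOn_multinomialMittagLeffler {β : Fin n → ℝ} (hβ : ∀ j, 0 < β j) {γ : ℝ}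
    (hγ : 0 < γ) (w : Fin n → ℝ) :
    ContinuousOn (multinomialMittagLeffler β γ) {z | ∀ j, |z j| ≤ |w j|} := by
  obtain ⟨C, -, h⟩ := exists_abs_mittagLefflerTerm_le hβ hγ w
  refine continuousOn_tsum (f := fun k z => mittagLefflerTerm β γ z k) (fun k => ?_)
    (summable_geometric_two.mul_left C) fun k z hz => h z hz k
  simp only [mittagLefflerTerm]
  fun_prop

theorem multinomialMittagLeffler_zero (β : Fin n → ℝ) (γ : ℝ) :
    multinomialMittagLeffler β γ 0 = 1 / Real.Gamma γ := by
  have h : ∀ k, k ≠ 0 → mittagLefflerTerm β γ 0 k = 0 := by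
    intro k hk
    obtain ⟨l, rfl⟩ := Nat.exists_eq_succ_of_ne_zero hk
    simp [Nat.succ_eq_add_one, mittagLefflerTerm_succ]
  rw [← mittagLefflerTerm_zero β γ 0]
  exact tsum_eq_single 0 h

end Series

/-! ### The kernel and its Volterra equation -/

section Kernel

variable {n : ℕ}

/-- The function `t ^ (γ - 1) * E_{β,γ}(c₁ t ^ β₁, …, c_n t ^ β_n)`. -/
noncomputable def mittagLefflerKernel (β c : Fin n → ℝ) (γ t : ℝ) : ℝ :=
  t ^ (γ - 1) * multinomialMittagLeffler β γ (fun j => c j * t ^ β j)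

theorem mittagLefflerKernel_eq_add_sum {β : Fin n → ℝ} (hβ : ∀ j, 0 < β j) (c : Fin n → ℝ)
    {γ t : ℝ} (hγ : 0 < γ) (ht : 0 < t) :
    mittagLefflerKernel β c γ t =
      fracKernel γ t + ∑ j, c j * mittagLefflerKernel β c (γ + β j) t := by
  rw [mittagLefflerKernel, multinomialMittagLeffler_eq_add_sum hβ hγ, mul_add, fracKernel,
    mul_one_div, Finset.mul_sum]
  congr 1
  refine Finset.sum_congr rfl fun j _ => ?_
  have h : t ^ (γ + β j - 1) = t ^ (γ - 1) * t ^ β j := by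
    rw [← Real.rpow_add ht]; congr 1; ring
  rw [mittagLefflerKernel, h]
  ring

theorem continuousOn_multinomialMittagLeffler_rpow {β : Fin n → ℝ} (hβ : ∀ j, 0 < β j)
    (c : Fin n → ℝ) {γ : ℝ} (hγ : 0 < γ) (t : ℝ) :
    ContinuousOn (fun s : ℝ => multinomialMittagLeffler β γ (fun j => c j * s ^ β j))
      (Set.Icc 0 t) := by
  refine (continuousOn_multinomialMittagLeffler hβ hγ (fun j => c j * t ^ β j)).comp
    (f := fun s : ℝ => fun j => c j * s ^ β j) ?_ ?_
  · exact continuousOn_pi.2 fun j => continuousOn_const.mul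
      (continuousOn_id.rpow_const fun s _ => Or.inr (hβ j).le)
  · intro s hs j
    have := Real.rpow_le_rpow hs.1 hs.2 (hβ j).le
    rw [abs_mul, abs_mul, abs_of_nonneg (Real.rpow_nonneg hs.1 _),
      abs_of_nonneg (Real.rpow_nonneg (hs.1.trans hs.2) _)]
    gcongr

theorem continuousOn_mittagLefflerKernel {β : Fin n → ℝ} (hβ : ∀ j, 0 < β j)
    (c : Fin n → ℝ) {γ : ℝ} (hγ : 0 < γ) (t : ℝ) :
    ContinuousOn (mittagLefflerKernel β c γ) (Set.Ioc 0 t) :=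
  (continuousOn_id.rpow_const fun _ hs => Or.inl (ne_of_gt hs.1)).mul
    ((continuousOn_multinomialMittagLeffler_rpow hβ c hγ t).mono Set.Ioc_subset_Icc_self)

theorem intervalIntegrable_mittagLefflerKernel {β : Fin n → ℝ} (hβ : ∀ j, 0 < β j)
    (c : Fin n → ℝ) {γ t : ℝ} (hγ : 0 < γ) (ht : 0 ≤ t) :
    IntervalIntegrable (mittagLefflerKernel β c γ) volume 0 t := by
  refine (intervalIntegral.intervalIntegrable_rpow' (by linarith)).mul_continuousOn ?_
  rw [Set.uIcc_of_le ht]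
  exact continuousOn_multinomialMittagLeffler_rpow hβ c hγ t

theorem intervalIntegrable_fracKernel_sub_mul_mittagLefflerKernel {β : Fin n → ℝ}
    (hβ : ∀ j, 0 < β j) (c : Fin n → ℝ) {a γ t : ℝ} (ha : 0 < a) (hγ : 0 < γ) (ht : 0 < t) :
    IntervalIntegrable (fun s => fracKernel a (t - s) * mittagLefflerKernel β c γ s)
      volume 0 t := by
  have h := (intervalIntegrable_fracKernel_sub_mul_rpow ha hγ ht).mul_continuousOn
    (g := fun s : ℝ => multinomialMittagLeffler β γ (fun j => c j * s ^ β j)) (by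
      rw [Set.uIcc_of_le ht.le]
      exact continuousOn_multinomialMittagLeffler_rpow hβ c hγ t)
  refine h.congr fun s _ => ?_
  simp only [mittagLefflerKernel, mul_assoc]

theorem rpow_mul_mittagLefflerTerm_rpow (β c : Fin n → ℝ) (γ : ℝ) {s : ℝ} (hs : 0 < s) (k : ℕ) :
    s ^ (γ - 1) * mittagLefflerTerm β γ (fun j => c j * s ^ β j) k =
      ∑ κ ∈ Finset.piAntidiag (Finset.univ : Finset (Fin n)) k,
        (Nat.multinomial Finset.univ κ : ℝ) * (∏ j, c j ^ κ j) *
          fracKernel (γ + ∑ j, β j * (κ j : ℝ)) s := by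
  rw [mittagLefflerTerm, Finset.mul_sum]
  refine Finset.sum_congr rfl fun κ _ => ?_
  have h : s ^ (γ + ∑ j, β j * (κ j : ℝ) - 1) = s ^ (γ - 1) * ∏ j, (s ^ β j) ^ κ j := by
    simp_rw [← Real.rpow_natCast, ← Real.rpow_mul hs.le]
    rw [← Real.rpow_sum_of_pos hs, ← Real.rpow_add hs]
    congr 1; ring
  simp_rw [mul_pow]
  rw [fracKernel, h, Finset.prod_mul_distrib]
  ring

theorem integral_fracKernel_sub_mul_fracKernel {a b t : ℝ} (ha : 0 < a) (hb : 0 < b) (ht : 0 < t) :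
    ∫ s in (0 : ℝ)..t, fracKernel a (t - s) * fracKernel b s = fracKernel (b + a) t := by
  have hΓ := (Real.Gamma_pos_of_pos hb).ne'
  have h := integral_fracKernel_sub_mul_rpow ha hb ht
  simp_rw [fracKernel.eq_1 b, ← mul_div_assoc]
  rw [intervalIntegral.integral_div, h]
  field_simp

theorem intervalIntegrable_fracKernel_sub_mul_fracKernel {a b t : ℝ} (ha : 0 < a) (hb : 0 < b)
    (ht : 0 < t) :
    IntervalIntegrable (fun s => fracKernel a (t - s) * fracKernel b s) volume 0 t := by
  simp_rw [fracKernel.eq_1 b, ← mul_div_assoc]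
  exact (intervalIntegrable_fracKernel_sub_mul_rpow ha hb ht).div_const _

theorem integral_fracKernel_sub_mul_mittagLefflerTerm {β : Fin n → ℝ} (hβ : ∀ j, 0 < β j)
    (c : Fin n → ℝ) {a γ t : ℝ} (ha : 0 < a) (hγ : 0 < γ) (ht : 0 < t) (k : ℕ) :
    ∫ s in (0 : ℝ)..t, fracKernel a (t - s) *
        (s ^ (γ - 1) * mittagLefflerTerm β γ (fun j => c j * s ^ β j) k) =
      t ^ (γ + a - 1) * mittagLefflerTerm β (γ + a) (fun j => c j * t ^ β j) k := by
  have hpos : ∀ κ : Fin n → ℕ, 0 < γ + ∑ j, β j * (κ j : ℝ) := fun κ =>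
    add_pos_of_pos_of_nonneg hγ
      (Finset.sum_nonneg fun j _ => mul_nonneg (hβ j).le (Nat.cast_nonneg _))
  have h1 : ∫ s in (0 : ℝ)..t, fracKernel a (t - s) *
        (s ^ (γ - 1) * mittagLefflerTerm β γ (fun j => c j * s ^ β j) k) =
      ∫ s in (0 : ℝ)..t, ∑ κ ∈ Finset.piAntidiag (Finset.univ : Finset (Fin n)) k,
        ((Nat.multinomial Finset.univ κ : ℝ) * (∏ j, c j ^ κ j)) *
          (fracKernel a (t - s) * fracKernel (γ + ∑ j, β j * (κ j : ℝ)) s) := by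
    refine intervalIntegral.integral_congr_ae (Filter.Eventually.of_forall fun s hs => ?_)
    rw [Set.uIoc_of_le ht.le] at hs
    rw [rpow_mul_mittagLefflerTerm_rpow β c γ hs.1, Finset.mul_sum]
    exact Finset.sum_congr rfl fun κ _ => by ring
  rw [h1, intervalIntegral.integral_finsetSum fun κ _ =>
      (intervalIntegrable_fracKernel_sub_mul_fracKernel ha (hpos κ) ht).const_mul _,
    rpow_mul_mittagLefflerTerm_rpow β c (γ + a) ht]
  refine Finset.sum_congr rfl fun κ _ => ?_
  rw [intervalIntegral.integral_const_mul, integral_fracKernel_sub_mul_fracKernel ha (hpos κ) ht,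
    add_right_comm]

/-- Each monomial is a multiple of some `k_b`, and `k_a * k_b = k_(a+b)`. Dominated convergence,
with the geometric bound on the box of the endpoint `t`, allows termwise integration. -/
theorem integral_fracKernel_sub_mul_mittagLefflerKernel {β : Fin n → ℝ} (hβ : ∀ j, 0 < β j)
    (c : Fin n → ℝ) {a γ t : ℝ} (ha : 0 < a) (hγ : 0 < γ) (ht : 0 < t) :
    ∫ s in (0 : ℝ)..t, fracKernel a (t - s) * mittagLefflerKernel β c γ s =
      mittagLefflerKernel β c (γ + a) t := by
  obtain ⟨C, hC, hbound⟩ := exists_abs_mittagLefflerTerm_le hβ hγ (fun j => c j * t ^ β j)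
  have hint := intervalIntegrable_fracKernel_sub_mul_rpow ha hγ ht
  have hsum : HasSum (fun k => ∫ s in (0 : ℝ)..t, fracKernel a (t - s) *
        (s ^ (γ - 1) * mittagLefflerTerm β γ (fun j => c j * s ^ β j) k))
      (∫ s in (0 : ℝ)..t, fracKernel a (t - s) * mittagLefflerKernel β c γ s) := by
    refine intervalIntegral.hasSum_integral_of_dominated_convergence
      (fun k s => fracKernel a (t - s) * s ^ (γ - 1) * (C * (1 / 2) ^ k)) (fun k => ?_)
      (fun k => Filter.Eventually.of_forall fun s hs => ?_)
      (Filter.Eventually.of_forall fun s _ => ?_) ?_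
      (Filter.Eventually.of_forall fun s _ => ?_)
    · have hc : Continuous fun s : ℝ => mittagLefflerTerm β γ (fun j => c j * s ^ β j) k := by
        have h (j : Fin n) : Continuous fun s : ℝ => s ^ β j :=
          Real.continuous_rpow_const (hβ j).le
        simp only [mittagLefflerTerm]
        fun_prop
      simp_rw [← mul_assoc]
      rw [Set.uIoc_of_le ht.le]
      exact hint.1.aestronglyMeasurable.mul hc.aestronglyMeasurable
    · rw [Set.uIoc_of_le ht.le] at hs
      have h1 : 0 ≤ fracKernel a (t - s) := fracKernel_nonneg ha (by linarith [hs.2])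
      have h2 : 0 ≤ s ^ (γ - 1) := Real.rpow_nonneg hs.1.le _
      rw [Real.norm_eq_abs, ← mul_assoc, abs_mul, abs_of_nonneg (mul_nonneg h1 h2)]
      refine mul_le_mul_of_nonneg_left (hbound _ (fun j => ?_) k) (mul_nonneg h1 h2)
      have := Real.rpow_le_rpow hs.1.le hs.2 (hβ j).le
      rw [abs_mul, abs_mul, abs_of_nonneg (Real.rpow_nonneg hs.1.le _),
        abs_of_nonneg (Real.rpow_nonneg ht.le _)]
      gcongr
    · exact (summable_geometric_two.mul_left C).mul_left _
    · simp_rw [tsum_mul_left]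
      exact hint.mul_const _
    · exact ((hasSum_mittagLefflerTerm hβ hγ _).mul_left _).mul_left _
  simp_rw [integral_fracKernel_sub_mul_mittagLefflerTerm hβ c ha hγ ht] at hsum
  exact hsum.unique ((hasSum_mittagLefflerTerm hβ (add_pos hγ ha) _).mul_left _)

/-- The multi-term Mittag-Leffler kernel solves a Volterra equation with weakly singular kernel. -/
theorem mittagLefflerKernel_eq_add_sum_integral {β : Fin n → ℝ} (hβ : ∀ j, 0 < β j)
    (c : Fin n → ℝ) {γ t : ℝ} (hγ : 0 < γ) (ht : 0 < t) :
    mittagLefflerKernel β c γ t = fracKernel γ t +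
      ∑ j, c j * ∫ s in (0 : ℝ)..t, fracKernel (β j) (t - s) * mittagLefflerKernel β c γ s := by
  rw [mittagLefflerKernel_eq_add_sum hβ c hγ ht]
  simp_rw [integral_fracKernel_sub_mul_mittagLefflerKernel hβ c (hβ _) hγ ht]

end Kernel

/-! ### Positivity of the kernel and bounds for its integral -/

section Positivity

variable {n : ℕ}

theorem fracKernel_one (t : ℝ) : fracKernel 1 t = 1 := by simp [fracKernel]

theorem integral_fracKernel_sub {b s t : ℝ} (hb : 0 < b) :
    ∫ x in s..t, fracKernel b (t - x) = fracKernel (b + 1) (t - s) := by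
  rw [intervalIntegral.integral_comp_sub_left (fracKernel b) t, sub_self]
  simp only [fracKernel]
  rw [intervalIntegral.integral_div, integral_rpow (Or.inl (by linarith)),
    Real.Gamma_add_one hb.ne', sub_add_cancel, Real.zero_rpow hb.ne', sub_zero, div_div,
    add_sub_cancel_right]

theorem intervalIntegrable_fracKernel_sub {b s t : ℝ} (hb : 0 < b) :
    IntervalIntegrable (fun x => fracKernel b (t - x)) volume s t := by
  have h := (intervalIntegral.intervalIntegrable_rpow' (a := t - s) (b := t - t)
    (r := b - 1) (by linarith)).comp_sub_left t
  simp only [sub_sub_cancel] at h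
  exact h.div_const _

theorem fracKernel_mono {b x y : ℝ} (hb : 1 ≤ b) (hx : 0 ≤ x) (hxy : x ≤ y) :
    fracKernel b x ≤ fracKernel b y :=
  div_le_div_of_nonneg_right (Real.rpow_le_rpow hx hxy (by linarith))
    (Real.Gamma_pos_of_pos (by linarith)).le

theorem fracKernel_anti {b x y : ℝ} (hb0 : 0 < b) (hb : b ≤ 1) (hx : 0 < x) (hxy : x ≤ y) :
    fracKernel b y ≤ fracKernel b x :=
  div_le_div_of_nonneg_right (Real.rpow_le_rpow_of_nonpos hx hxy (by linarith))
    (Real.Gamma_pos_of_pos hb0).le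

/-- Since `(T - s)/(t - s) ≥ T/t ≥ 1` and `b - 1 ≤ r - 1 ≤ 0`, one factor serves all orders `b ≤ r`
and all `s`. It is exactly the factor relating `k_r(T)` to `k_r(t)`. -/
theorem fracKernel_sub_le_rpow_mul {b r s t T : ℝ} (hb0 : 0 < b) (hbr : b ≤ r) (hr : r ≤ 1)
    (hs : 0 < s) (hst : s < t) (htT : t ≤ T) :
    fracKernel b (T - s) ≤ (T / t) ^ (r - 1) * fracKernel b (t - s) := by
  have ht : 0 < t := hs.trans hst
  have h1 : 1 ≤ T / t := (one_le_div ht).2 htT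
  have h2 : T / t ≤ (T - s) / (t - s) := by
    rw [div_le_div_iff₀ ht (by linarith)]
    nlinarith
  have h3 : ((T - s) / (t - s)) ^ (b - 1) ≤ (T / t) ^ (r - 1) :=
    (Real.rpow_le_rpow_of_nonpos (by linarith) h2 (by linarith)).trans
      (Real.rpow_le_rpow_of_exponent_le h1 (by linarith))
  rw [Real.div_rpow (by linarith) (by linarith),
    div_le_iff₀ (Real.rpow_pos_of_pos (by linarith) _)] at h3
  rw [fracKernel, fracKernel, ← mul_div_assoc]
  exact div_le_div_of_nonneg_right h3 (Real.Gamma_pos_of_pos hb0).le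

theorem exists_sum_mul_fracKernel_lt {β d : Fin n → ℝ} (hβ : ∀ j, 0 < β j) {t ε : ℝ}
    (ht : 0 < t) (hε : 0 < ε) :
    ∃ x, 0 < x ∧ x ≤ t ∧ ∑ j, d j * fracKernel (β j + 1) x < ε := by
  have h0 : ∀ j, fracKernel (β j + 1) 0 = 0 := fun j => by
    simp [fracKernel, Real.zero_rpow (hβ j).ne']
  have hc : Continuous fun x : ℝ => ∑ j, d j * fracKernel (β j + 1) x := by
    refine continuous_finsetSum _ fun j _ => continuous_const.mul ?_
    exact (Real.continuous_rpow_const (by linarith [hβ j])).div_const _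
  have hlim : Filter.Tendsto (fun x : ℝ => ∑ j, d j * fracKernel (β j + 1) x)
      (nhdsWithin 0 (Set.Ioi 0)) (nhds 0) := by
    have := hc.tendsto 0
    simp only [h0, mul_zero, Finset.sum_const_zero] at this
    exact this.mono_left nhdsWithin_le_nhds
  obtain ⟨x, h1, h2⟩ := ((hlim.eventually_lt_const hε).and
    (Ioc_mem_nhdsGT ht)).exists
  exact ⟨x, h2.1, h2.2, h1⟩

/-- Positivity of the multi-term Mittag-Leffler kernel. -/
theorem mittagLefflerKernel_pos {β d : Fin n → ℝ} {r : ℝ} (hβ : ∀ j, 0 < β j)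
    (hβr : ∀ j, β j ≤ r) (hr0 : 0 < r) (hr : r ≤ 1) (hd : ∀ j, 0 ≤ d j) {t : ℝ} (ht : 0 < t) :
    0 < mittagLefflerKernel β (fun j => -d j) r t := by
  set u := mittagLefflerKernel β (fun j => -d j) r with hu
  -- Without the singular factor the kernel is continuous up to 0, with `v 0 = 1/Γ(r) > 0`, so a
  -- first point `t₁` with `v ≤ 0` exists if positivity fails.
  set v : ℝ → ℝ := fun s => multinomialMittagLeffler β r (fun j => -d j * s ^ β j) with hv
  have hvc : ContinuousOn v (Set.Icc 0 t) := continuousOn_multinomialMittagLeffler_rpow hβ _ hr0 t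
  have huv : ∀ s, u s = s ^ (r - 1) * v s := fun s => rfl
  have hv0 : 0 < v 0 := by
    have h : (fun j => -d j * (0 : ℝ) ^ β j) = 0 := by
      ext j; simp [Real.zero_rpow (hβ j).ne']
    simp only [hv]
    rw [h, multinomialMittagLeffler_zero]
    exact one_div_pos.2 (Real.Gamma_pos_of_pos hr0)
  have hvolt : ∀ s, 0 < s → u s = fracKernel r s -
      ∑ j, d j * ∫ x in (0 : ℝ)..s, fracKernel (β j) (s - x) * u x := by
    intro s hs
    rw [hu, mittagLefflerKernel_eq_add_sum_integral hβ _ hr0 hs]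
    simp [sub_eq_add_neg]
  by_contra! hneg
  have hvt : v t ≤ 0 := by
    rw [huv] at hneg
    exact nonpos_of_mul_nonpos_right hneg (Real.rpow_pos_of_pos ht _)
  have hclosed : IsClosed (Set.Icc 0 t ∩ v ⁻¹' Set.Iic 0) :=
    hvc.preimage_isClosed_of_isClosed isClosed_Icc isClosed_Iic
  obtain ⟨t₁, ⟨ht₁, hvt₁⟩, hleast⟩ :=
    (isCompact_Icc.of_isClosed_subset hclosed Set.inter_subset_left).exists_isLeast
      ⟨t, ⟨ht.le, le_rfl⟩, hvt⟩
  have hvt₁ : v t₁ ≤ 0 := hvt₁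
  have ht₁0 : 0 < t₁ := lt_of_le_of_ne ht₁.1 fun h => by rw [← h] at hvt₁; linarith
  have hpos : ∀ s, 0 < s → s < t₁ → 0 < u s := by
    intro s hs hst
    rw [huv]
    refine mul_pos (Real.rpow_pos_of_pos hs _) ?_
    by_contra! h
    exact absurd (hleast ⟨⟨hs.le, hst.le.trans ht₁.2⟩, h⟩) (not_le.2 hst)
  have hut₁ : u t₁ ≤ 0 := by
    rw [huv]
    exact mul_nonpos_of_nonneg_of_nonpos (Real.rpow_nonneg ht₁.1 _) hvt₁
  -- The window length `x ≤ t₁/2` gives `t₁/τ ≤ 2`, hence `κ ≥ 1/2`, while the recent memory `∑ d_j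
  -- k_{β_j+1}(x)` stays below 1/2.
  obtain ⟨x, hx0, hxt, hx⟩ := exists_sum_mul_fracKernel_lt (d := d) hβ (half_pos ht₁0)
    (half_pos one_pos)
  have huc : ContinuousOn u (Set.Icc (t₁ - x) t₁) :=
    (continuousOn_mittagLefflerKernel hβ _ hr0 t₁).mono fun s hs => ⟨by linarith [hs.1], hs.2⟩
  obtain ⟨τ, hτ, hmax⟩ := isCompact_Icc.exists_isMaxOn
    (Set.nonempty_Icc.2 (by linarith : t₁ - x ≤ t₁)) huc
  have hmax : ∀ s ∈ Set.Icc (t₁ - x) t₁, u s ≤ u τ := hmax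
  have huτ : 0 < u τ := (hpos (t₁ - x) (by linarith) (by linarith)).trans_le
    (hmax _ ⟨le_rfl, by linarith⟩)
  have hτt₁ : τ < t₁ := lt_of_le_of_ne hτ.2 fun h => by rw [h] at huτ; linarith
  have hτ0 : 0 < τ := by linarith [hτ.1]
  have hint : ∀ j, IntervalIntegrable (fun s => fracKernel (β j) (t₁ - s) * u s) volume 0 t₁ :=
    fun j => intervalIntegrable_fracKernel_sub_mul_mittagLefflerKernel hβ _ (hβ j) hr0 ht₁0
  have hint1 : ∀ j, IntervalIntegrable (fun s => fracKernel (β j) (t₁ - s) * u s) volume 0 τ :=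
    fun j => (hint j).mono_set (Set.uIcc_subset_uIcc_left (Set.mem_uIcc_of_le hτ0.le hτ.2))
  have hint2 : ∀ j, IntervalIntegrable (fun s => fracKernel (β j) (t₁ - s) * u s) volume τ t₁ :=
    fun j => (hint j).mono_set (Set.uIcc_subset_uIcc_right (Set.mem_uIcc_of_le hτ0.le hτ.2))
  have hint3 : ∀ j, IntervalIntegrable (fun s => fracKernel (β j) (τ - s) * u s) volume 0 τ :=
    fun j => intervalIntegrable_fracKernel_sub_mul_mittagLefflerKernel hβ _ (hβ j) hr0 hτ0
  set κ := (t₁ / τ) ^ (r - 1) with hκ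
  have hκ_half : 1 / 2 ≤ κ := by
    have h1 : t₁ / τ ≤ 2 := by
      rw [div_le_iff₀ hτ0]; linarith [hτ.1]
    calc (1 / 2 : ℝ) = 2 ^ (-1 : ℝ) := by norm_num [Real.rpow_neg_one]
      _ ≤ 2 ^ (r - 1) := Real.rpow_le_rpow_of_exponent_le (by norm_num) (by linarith)
      _ ≤ κ := Real.rpow_le_rpow_of_nonpos (by positivity) h1 (by linarith)
  have hfrac : fracKernel r t₁ = κ * fracKernel r τ := by
    have := (Real.rpow_pos_of_pos hτ0 (r - 1)).ne'
    rw [hκ, fracKernel, fracKernel, Real.div_rpow ht₁0.le hτ0.le]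
    field_simp
  -- On `[0, τ]` the memory at `t₁` is at most `κ` times that at `τ`; on `[τ, t₁]`, `u` is at most
  -- its maximum `u τ`.
  have hsplit : ∀ j, ∫ s in (0 : ℝ)..t₁, fracKernel (β j) (t₁ - s) * u s ≤
      κ * (∫ s in (0 : ℝ)..τ, fracKernel (β j) (τ - s) * u s) +
        u τ * fracKernel (β j + 1) x := by
    intro j
    rw [← intervalIntegral.integral_add_adjacent_intervals (hint1 j) (hint2 j)]
    refine add_le_add ?_ ?_
    · rw [← intervalIntegral.integral_const_mul]
      refine intervalIntegral.integral_mono_on_of_le_Ioo hτ0.le (hint1 j)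
        ((hint3 j).const_mul κ) fun s hs => ?_
      rw [← mul_assoc]
      exact mul_le_mul_of_nonneg_right
        (fracKernel_sub_le_rpow_mul (hβ j) (hβr j) hr hs.1 hs.2 hτ.2)
        (hpos s hs.1 (hs.2.trans hτt₁)).le
    · calc ∫ s in τ..t₁, fracKernel (β j) (t₁ - s) * u s
          ≤ ∫ s in τ..t₁, u τ * fracKernel (β j) (t₁ - s) := by
            refine intervalIntegral.integral_mono_on_of_le_Ioo hτ.2 (hint2 j)
              ((intervalIntegrable_fracKernel_sub (hβ j)).const_mul _) fun s hs => ?_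
            rw [mul_comm]
            exact mul_le_mul_of_nonneg_right (hmax s ⟨hτ.1.trans hs.1.le, hs.2.le⟩)
              (fracKernel_nonneg (hβ j) (by linarith [hs.2]))
        _ = u τ * fracKernel (β j + 1) (t₁ - τ) := by
            rw [intervalIntegral.integral_const_mul, integral_fracKernel_sub (hβ j)]
        _ ≤ u τ * fracKernel (β j + 1) x :=
            mul_le_mul_of_nonneg_left (fracKernel_mono (by linarith [hβ j]) (by linarith)
              (by linarith [hτ.1])) huτ.le
  have hsum := Finset.sum_le_sum fun j (_ : j ∈ Finset.univ) =>
    mul_le_mul_of_nonneg_left (hsplit j) (hd j)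
  have hrw : ∑ j, d j * (κ * (∫ s in (0 : ℝ)..τ, fracKernel (β j) (τ - s) * u s) +
        u τ * fracKernel (β j + 1) x) =
      κ * (fracKernel r τ - u τ) + u τ * ∑ j, d j * fracKernel (β j + 1) x := by
    rw [hvolt τ hτ0, sub_sub_cancel, ← hvolt τ hτ0, Finset.mul_sum, Finset.mul_sum,
      ← Finset.sum_add_distrib]
    exact Finset.sum_congr rfl fun j _ => by ring
  rw [hrw] at hsum
  have h1 := hvolt t₁ ht₁0
  -- Altogether `u t₁ ≥ u τ * (κ - ∑ d_j k_{β_j+1}(x)) > 0`, contradicting `u t₁ ≤ 0`.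
  nlinarith [mul_lt_mul_of_pos_left hx huτ]

/-- As `u(t) > 0`, the Volterra equation forces `d_i (k_r * u)(t) ≤ k_r(t)`. Since `k_r` decreases,
`k_r(t) ∫₀ᵗ u ≤ (k_r * u)(t)`; cancel `k_r(t)`. -/
theorem mul_integral_mittagLefflerKernel_le_one {β d : Fin n → ℝ} {r : ℝ} (hβ : ∀ j, 0 < β j)
    (hβr : ∀ j, β j ≤ r) (hr0 : 0 < r) (hr : r ≤ 1) (hd : ∀ j, 0 ≤ d j) {i : Fin n}
    (hi : β i = r) {t : ℝ} (ht : 0 < t) :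
    d i * ∫ s in (0 : ℝ)..t, mittagLefflerKernel β (fun j => -d j) r s ≤ 1 := by
  have hpos : ∀ s, 0 < s → 0 < mittagLefflerKernel β (fun j => -d j) r s := fun s hs =>
    mittagLefflerKernel_pos hβ hβr hr0 hr hd hs
  have hvolt := mittagLefflerKernel_eq_add_sum_integral hβ (fun j => -d j) hr0 ht
  simp only [neg_mul, Finset.sum_neg_distrib] at hvolt
  have hnonneg : ∀ j, 0 ≤ d j * ∫ s in (0 : ℝ)..t,
      fracKernel (β j) (t - s) * mittagLefflerKernel β (fun j => -d j) r s := by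
    intro j
    refine mul_nonneg (hd j) ?_
    rw [intervalIntegral.integral_of_le ht.le]
    exact setIntegral_nonneg measurableSet_Ioc fun s hs =>
      mul_nonneg (fracKernel_nonneg (hβ j) (by linarith [hs.2])) (hpos s hs.1).le
  have hle := Finset.single_le_sum (fun j _ => hnonneg j) (Finset.mem_univ i)
  have hmono : fracKernel r t * ∫ s in (0 : ℝ)..t, mittagLefflerKernel β (fun j => -d j) r s ≤
      ∫ s in (0 : ℝ)..t, fracKernel (β i) (t - s) * mittagLefflerKernel β (fun j => -d j) r s := by
    rw [← intervalIntegral.integral_const_mul]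
    refine intervalIntegral.integral_mono_on_of_le_Ioo ht.le
      ((intervalIntegrable_mittagLefflerKernel hβ _ hr0 ht.le).const_mul _)
      (intervalIntegrable_fracKernel_sub_mul_mittagLefflerKernel hβ _ (hβ i) hr0 ht)
      fun s hs => ?_
    rw [hi]
    exact mul_le_mul_of_nonneg_right (fracKernel_anti hr0 hr (by linarith [hs.2])
      (by linarith [hs.1])) (hpos s hs.1).le
  have hf := fracKernel_pos hr0 ht
  have hut := hpos t ht
  refine le_of_mul_le_mul_left ?_ hf
  have := mul_le_mul_of_nonneg_left hmono (hd i)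
  linarith

/-- Integrated once, the equation has memory kernels `k_{β_j+1}`. These increase, so each
convolution with `u ≥ 0` is at most `k_{β_j+1}(t) ∫₀ᵗ u`. -/
theorem fracKernel_le_integral_mittagLefflerKernel_mul {β d : Fin n → ℝ} {r : ℝ}
    (hβ : ∀ j, 0 < β j) (hβr : ∀ j, β j ≤ r) (hr0 : 0 < r) (hr : r ≤ 1) (hd : ∀ j, 0 ≤ d j)
    {t : ℝ} (ht : 0 < t) :
    fracKernel (r + 1) t ≤ (∫ s in (0 : ℝ)..t, mittagLefflerKernel β (fun j => -d j) r s) *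
      (1 + ∑ j, d j * fracKernel (β j + 1) t) := by
  set F := ∫ s in (0 : ℝ)..t, mittagLefflerKernel β (fun j => -d j) r s with hF
  have hpos : ∀ s, 0 < s → 0 < mittagLefflerKernel β (fun j => -d j) r s := fun s hs =>
    mittagLefflerKernel_pos hβ hβr hr0 hr hd hs
  have heq := mittagLefflerKernel_eq_add_sum hβ (fun j => -d j) (add_pos hr0 one_pos) ht
  have hone := integral_fracKernel_sub_mul_mittagLefflerKernel hβ (fun j => -d j) one_pos hr0 ht
  simp only [fracKernel_one, one_mul] at hone
  rw [← hone, ← hF] at heq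
  have hle : ∀ j, mittagLefflerKernel β (fun j => -d j) (r + 1 + β j) t ≤
      fracKernel (β j + 1) t * F := by
    intro j
    have hj : 0 < β j + 1 := by linarith [hβ j]
    have h : r + 1 + β j = r + (β j + 1) := by ring
    rw [h, ← integral_fracKernel_sub_mul_mittagLefflerKernel hβ _ hj hr0 ht, hF,
      ← intervalIntegral.integral_const_mul]
    refine intervalIntegral.integral_mono_on_of_le_Ioo ht.le
      (intervalIntegrable_fracKernel_sub_mul_mittagLefflerKernel hβ _ hj hr0 ht)
      ((intervalIntegrable_mittagLefflerKernel hβ _ hr0 ht.le).const_mul _) fun s hs => ?_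
    exact mul_le_mul_of_nonneg_right (fracKernel_mono (by linarith [hβ j]) (by linarith [hs.2])
      (by linarith [hs.1])) (hpos s hs.1).le
  have hsum := Finset.sum_le_sum fun j (_ : j ∈ Finset.univ) =>
    mul_le_mul_of_nonneg_left (hle j) (hd j)
  simp only [neg_mul, Finset.sum_neg_distrib] at heq
  have hrw : ∑ j, d j * (fracKernel (β j + 1) t * F) =
      F * ∑ j, d j * fracKernel (β j + 1) t := by
    rw [Finset.mul_sum]
    exact Finset.sum_congr rfl fun j _ => by ring
  rw [hrw] at hsum
  linarith

end Positivity

/-! ### Application to the coefficients -/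

section Coefficients

variable {m : ℕ}

theorem rhoPrime_pos {ρ : Fin (m + 1) → ℝ} (hρ : ∀ j, 0 < ρ j) (hρ_anti : StrictAnti ρ)
    (j : Fin (m + 1)) : 0 < rhoPrime ρ j := by
  cases j using Fin.cases with
  | zero => exact hρ 0
  | succ j => exact sub_pos.2 (hρ_anti (Fin.succ_pos j))

theorem rhoPrime_le {ρ : Fin (m + 1) → ℝ} (hρ : ∀ j, 0 < ρ j) (j : Fin (m + 1)) :
    rhoPrime ρ j ≤ ρ 0 := by
  cases j using Fin.cases with
  | zero => exact le_rfl
  | succ j => exact sub_le_self _ (hρ j.succ).le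

/-- The coefficients `(l, q₂, …, q_M)`. -/
def consCoeff (q : Fin (m + 1) → ℝ) (l : ℝ) : Fin (m + 1) → ℝ :=
  Fin.cons l (fun j : Fin m => q j.succ)

theorem consCoeff_nonneg {q : Fin (m + 1) → ℝ} (hq : ∀ j, 0 < q j) {l : ℝ} (hl : 0 ≤ l)
    (j : Fin (m + 1)) : 0 ≤ consCoeff q l j := by
  cases j using Fin.cases with
  | zero => exact hl
  | succ j => exact (hq j.succ).le

/-- The kernel `ξ ^ (ρ₁ - 1) * E_{ρ',ρ₁}(-l ξ ^ ρ₁, *)` of `bCoeff`. -/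
noncomputable def coeffKernel (ρ q : Fin (m + 1) → ℝ) (l : ℝ) : ℝ → ℝ :=
  mittagLefflerKernel (rhoPrime ρ) (fun j => -consCoeff q l j) (ρ 0)

theorem coeffKernel_eq (ρ q : Fin (m + 1) → ℝ) (l t : ℝ) :
    coeffKernel ρ q l t = t ^ (ρ 0 - 1) * mittagLefflerAt ρ q (ρ 0) l t := by
  rw [coeffKernel, mittagLefflerKernel, mittagLefflerAt]
  congr 2
  ext j
  cases j using Fin.cases with
  | zero => rfl
  | succ j => rfl

theorem bCoeff_eq_integral_coeffKernel (ρ q : Fin (m + 1) → ℝ) (lam : ℕ → ℝ) (g : ℝ → ℝ) (k : ℕ)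
    (t : ℝ) : bCoeff ρ q lam g k t = ∫ ξ in (0 : ℝ)..t, g (t - ξ) * coeffKernel ρ q (lam k) ξ := by
  simp only [bCoeff, coeffKernel_eq, mul_assoc]

theorem coeffKernel_pos {ρ q : Fin (m + 1) → ℝ} (hρ : ∀ j, ρ j ∈ Set.Ioo (0 : ℝ) 1)
    (hρ_anti : StrictAnti ρ) (hq : ∀ j, 0 < q j) {l t : ℝ} (hl : 0 ≤ l) (ht : 0 < t) :
    0 < coeffKernel ρ q l t :=
  mittagLefflerKernel_pos (rhoPrime_pos (fun j => (hρ j).1) hρ_anti)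
    (rhoPrime_le fun j => (hρ j).1) (hρ 0).1 (hρ 0).2.le (consCoeff_nonneg hq hl) ht

theorem intervalIntegrable_coeffKernel {ρ : Fin (m + 1) → ℝ} (q : Fin (m + 1) → ℝ)
    (hρ : ∀ j, ρ j ∈ Set.Ioo (0 : ℝ) 1) (hρ_anti : StrictAnti ρ) (l : ℝ) {t : ℝ} (ht : 0 ≤ t) :
    IntervalIntegrable (coeffKernel ρ q l) volume 0 t :=
  intervalIntegrable_mittagLefflerKernel (rhoPrime_pos (fun j => (hρ j).1) hρ_anti) _ (hρ 0).1 ht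

theorem mul_integral_coeffKernel_le_one {ρ q : Fin (m + 1) → ℝ}
    (hρ : ∀ j, ρ j ∈ Set.Ioo (0 : ℝ) 1) (hρ_anti : StrictAnti ρ) (hq : ∀ j, 0 < q j)
    {l t : ℝ} (hl : 0 ≤ l) (ht : 0 < t) :
    l * ∫ ξ in (0 : ℝ)..t, coeffKernel ρ q l ξ ≤ 1 :=
  mul_integral_mittagLefflerKernel_le_one (i := 0)
    (rhoPrime_pos (fun j => (hρ j).1) hρ_anti) (rhoPrime_le fun j => (hρ j).1) (hρ 0).1
    (hρ 0).2.le (consCoeff_nonneg hq hl) rfl ht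

theorem exists_le_integral_coeffKernel_mul {ρ q : Fin (m + 1) → ℝ}
    (hρ : ∀ j, ρ j ∈ Set.Ioo (0 : ℝ) 1) (hρ_anti : StrictAnti ρ) (hq : ∀ j, 0 < q j)
    {t : ℝ} (ht : 0 < t) :
    ∃ A K : ℝ, 0 < A ∧ 0 < K ∧ ∀ l, 0 ≤ l →
      K ≤ (∫ ξ in (0 : ℝ)..t, coeffKernel ρ q l ξ) * (A + l * K) := by
  have hpos := rhoPrime_pos (fun j => (hρ j).1) hρ_anti
  refine ⟨1 + ∑ j : Fin m, q j.succ * fracKernel (rhoPrime ρ j.succ + 1) t,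
    fracKernel (ρ 0 + 1) t, ?_, fracKernel_pos (by linarith [(hρ 0).1]) ht, fun l hl => ?_⟩
  · have : 0 ≤ ∑ j : Fin m, q j.succ * fracKernel (rhoPrime ρ j.succ + 1) t :=
      Finset.sum_nonneg fun j _ => mul_nonneg (hq _).le
        (fracKernel_nonneg (by linarith [hpos j.succ]) ht.le)
    linarith
  · have h := fracKernel_le_integral_mittagLefflerKernel_mul hpos
      (rhoPrime_le fun j => (hρ j).1) (hρ 0).1 (hρ 0).2.le (consCoeff_nonneg hq hl) ht
    -- The term `j = 0` has order `ρ 0` and coefficient `l`, so it equals `l * K`; the remaining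
    -- terms, free of `l`, make up `A`.
    rw [Fin.sum_univ_succ] at h
    refine h.trans (le_of_eq ?_)
    simp only [coeffKernel, consCoeff, rhoPrime, Fin.cons_zero, Fin.cons_succ]
    ring

theorem exists_forall_le_mul_integral_coeffKernel {ρ q : Fin (m + 1) → ℝ}
    (hρ : ∀ j, ρ j ∈ Set.Ioo (0 : ℝ) 1) (hρ_anti : StrictAnti ρ) (hq : ∀ j, 0 < q j)
    {t l₀ : ℝ} (ht : 0 < t) (hl₀ : 0 < l₀) :
    ∃ c : ℝ, 0 < c ∧ ∀ l, l₀ ≤ l → c ≤ l * ∫ ξ in (0 : ℝ)..t, coeffKernel ρ q l ξ := by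
  obtain ⟨A, K, hA, hK, h⟩ := exists_le_integral_coeffKernel_mul hρ hρ_anti hq ht
  refine ⟨l₀ * K / (A + l₀ * K), by positivity, fun l hl => ?_⟩
  have hl0 : 0 < l := hl₀.trans_le hl
  have h1 : l * K / (A + l * K) ≤ l * ∫ ξ in (0 : ℝ)..t, coeffKernel ρ q l ξ := by
    rw [div_le_iff₀ (by positivity), mul_assoc]
    exact mul_le_mul_of_nonneg_left (h l hl0.le) hl0.le
  refine le_trans ?_ h1
  -- The function `l ↦ lK/(A + lK)` increases, so its value at `l₀` is a lower bound.
  rw [div_le_div_iff₀ (by positivity) (by positivity)]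
  have := mul_le_mul_of_nonneg_right hl (mul_pos hK hA).le
  linarith

theorem eventually_half_le_mul_integral_coeffKernel {ρ q : Fin (m + 1) → ℝ}
    (hρ : ∀ j, ρ j ∈ Set.Ioo (0 : ℝ) 1) (hρ_anti : StrictAnti ρ) (hq : ∀ j, 0 < q j)
    {t : ℝ} (ht : 0 < t) :
    ∀ᶠ l in Filter.atTop, 1 / 2 ≤ l * ∫ ξ in (0 : ℝ)..t, coeffKernel ρ q l ξ := by
  obtain ⟨A, K, hA, hK, h⟩ := exists_le_integral_coeffKernel_mul hρ hρ_anti hq ht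
  -- From here on `A ≤ lK`, so `lK/(A + lK) ≥ 1/2`.
  filter_upwards [Filter.eventually_ge_atTop (A / K)] with l hl
  have hl0 : 0 < l := (div_pos hA hK).trans_le hl
  rw [div_le_iff₀ hK] at hl
  have h1 := mul_le_mul_of_nonneg_left (h l hl0.le) hl0.le
  rw [← mul_assoc] at h1
  by_contra! h2
  have := mul_lt_mul_of_pos_right h2 (by positivity : 0 < A + l * K)
  linarith

theorem exists_forall_abs_half_le {T : ℝ} (hT : 0 < T) {g : ℝ → ℝ}
    (hg : ContinuousOn g (Set.Icc 0 T)) (hg_zero : g 0 ≠ 0) :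
    ∃ r, 0 < r ∧ r ≤ T ∧ ∃ ε : ℝ, |ε| = 1 ∧ ∀ x ∈ Set.Icc 0 r,
      |g 0| / 2 ≤ ε * g x ∧ ε * g x ≤ 2 * |g 0| := by
  have h0 : 0 < |g 0| := abs_pos.2 hg_zero
  obtain ⟨δ, hδ, h⟩ := Metric.continuousOn_iff.1 hg 0 ⟨le_rfl, hT.le⟩ (|g 0| / 2) (half_pos h0)
  -- Halving `δ` keeps the closed interval inside the open ball of continuity; `ε` is the sign of `g
  -- 0`.
  refine ⟨min (δ / 2) T, lt_min (half_pos hδ) hT, min_le_right _ _, SignType.sign (g 0), ?_,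
    fun x hx => ?_⟩
  · rcases hg_zero.lt_or_gt with h | h <;> simp [h]
  · have hxδ : x ≤ δ / 2 := hx.2.trans (min_le_left _ _)
    have h1 := h x ⟨hx.1, hx.2.trans (min_le_right _ _)⟩ (by
      rw [Real.dist_eq, sub_zero, abs_of_nonneg hx.1]; linarith)
    rw [Real.dist_eq, abs_lt] at h1
    rcases hg_zero.lt_or_gt with h | h
    · simp only [sign_neg h, abs_of_neg h] at h1 h0 ⊢
      simp only [SignType.coe_neg, SignType.coe_one]
      constructor <;> linarith
    · simp only [sign_pos h, abs_of_pos h] at h1 h0 ⊢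
      simp only [SignType.coe_one]
      constructor <;> linarith

theorem abs_integral_mul_mem_Icc {u f : ℝ → ℝ} {t a b ε : ℝ} (ht : 0 ≤ t) (hε : |ε| = 1)
    (hf : ContinuousOn f (Set.Icc 0 t)) (hu : IntervalIntegrable u volume 0 t)
    (hu0 : ∀ s, 0 < s → 0 ≤ u s) (ha : 0 ≤ a)
    (hab : ∀ x ∈ Set.Icc 0 t, a ≤ ε * f x ∧ ε * f x ≤ b) :
    |∫ ξ in (0 : ℝ)..t, f (t - ξ) * u ξ| ∈
      Set.Icc (a * ∫ ξ in (0 : ℝ)..t, u ξ) (b * ∫ ξ in (0 : ℝ)..t, u ξ) := by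
  have hmem : ∀ ξ ∈ Set.Icc 0 t, t - ξ ∈ Set.Icc 0 t := fun ξ hξ =>
    ⟨by linarith [hξ.2], by linarith [hξ.1]⟩
  have hint : IntervalIntegrable (fun ξ => (ε * f (t - ξ)) * u ξ) volume 0 t := by
    refine hu.continuousOn_mul ?_
    rw [Set.uIcc_of_le ht]
    exact continuousOn_const.mul (hf.comp (by fun_prop) hmem)
  have habs : |∫ ξ in (0 : ℝ)..t, f (t - ξ) * u ξ| =
      |∫ ξ in (0 : ℝ)..t, (ε * f (t - ξ)) * u ξ| := by
    simp_rw [mul_assoc]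
    rw [intervalIntegral.integral_const_mul, abs_mul, hε, one_mul]
  have hI : 0 ≤ ∫ ξ in (0 : ℝ)..t, u ξ := by
    rw [intervalIntegral.integral_of_le ht]
    exact setIntegral_nonneg measurableSet_Ioc fun s hs => hu0 s hs.1
  have hlow : a * ∫ ξ in (0 : ℝ)..t, u ξ ≤ ∫ ξ in (0 : ℝ)..t, (ε * f (t - ξ)) * u ξ := by
    rw [← intervalIntegral.integral_const_mul]
    exact intervalIntegral.integral_mono_on_of_le_Ioo ht (hu.const_mul a) hint fun s hs =>
      mul_le_mul_of_nonneg_right (hab _ (hmem s ⟨hs.1.le, hs.2.le⟩)).1 (hu0 s hs.1)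
  have hupp : ∫ ξ in (0 : ℝ)..t, (ε * f (t - ξ)) * u ξ ≤ b * ∫ ξ in (0 : ℝ)..t, u ξ := by
    rw [← intervalIntegral.integral_const_mul]
    exact intervalIntegral.integral_mono_on_of_le_Ioo ht hint (hu.const_mul b) fun s hs =>
      mul_le_mul_of_nonneg_right (hab _ (hmem s ⟨hs.1.le, hs.2.le⟩)).2 (hu0 s hs.1)
  rw [habs, abs_of_nonneg ((mul_nonneg ha hI).trans hlow)]
  exact ⟨hlow, hupp⟩

end Coefficients

/-! ### The two-sided estimate -/

theorem lemma6 (m : ℕ) (ρ q : Fin (m + 1) → ℝ)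
    (hρ : ∀ j, ρ j ∈ Set.Ioo (0 : ℝ) 1) (hρ_anti : StrictAnti ρ)
    (hq : ∀ j, 0 < q j) (hq_one : q 0 = 1)
    (lam : ℕ → ℝ) (hlam_pos : ∀ k, 0 < lam k) (hlam_mono : Monotone lam)
    (hlam_lim : Filter.Tendsto lam Filter.atTop Filter.atTop)
    (T : ℝ) (hT : 0 < T) (g : ℝ → ℝ) (hg : ContDiffOn ℝ 1 g (Set.Icc 0 T)) (hg_zero : g 0 ≠ 0) :
    ∃ r₀ : ℝ, 0 < r₀ ∧ r₀ ≤ T ∧ ∃ C₁ : ℝ, 0 < C₁ ∧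
      -- the index threshold is the same for all `t₀`, the lower constant may depend on `t₀`
      (∃ k₀ : ℕ, ∀ t₀ ∈ Set.Ioc 0 r₀, ∃ C₀ : ℝ, 0 < C₀ ∧ ∀ k, k₀ ≤ k →
        C₀ / lam k ≤ |bCoeff ρ q lam g k t₀| ∧ |bCoeff ρ q lam g k t₀| ≤ C₁ / lam k) ∧
      -- both constants are the same for all `t₀`, the index threshold may depend on `t₀`
      (∃ C₀ : ℝ, 0 < C₀ ∧ ∀ t₀ ∈ Set.Ioc 0 r₀, ∃ k₀ : ℕ, ∀ k, k₀ ≤ k →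
        C₀ / lam k ≤ |bCoeff ρ q lam g k t₀| ∧ |bCoeff ρ q lam g k t₀| ≤ C₁ / lam k) ∧
      -- the two-sided estimate for all indices with nonzero coefficient
      (∀ t₀ ∈ Set.Ioc 0 r₀, ∃ C₀ : ℝ, 0 < C₀ ∧ ∀ k ∈ KNonzero ρ q lam g t₀,
        C₀ / lam k ≤ |bCoeff ρ q lam g k t₀| ∧ |bCoeff ρ q lam g k t₀| ≤ C₁ / lam k) ∧
      -- only finitely many coefficients vanish
      (∀ t₀ ∈ Set.Ioc 0 r₀, (KZero ρ q lam g t₀).Finite) := by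
  obtain ⟨r, hr0, hrT, ε, hε, hgε⟩ := exists_forall_abs_half_le hT hg.continuousOn hg_zero
  have h0 : 0 < |g 0| := abs_pos.2 hg_zero
  have hmem : ∀ t ∈ Set.Ioc 0 r, ∀ k, |bCoeff ρ q lam g k t| ∈
      Set.Icc (|g 0| / 2 * ∫ ξ in (0 : ℝ)..t, coeffKernel ρ q (lam k) ξ)
        (2 * |g 0| * ∫ ξ in (0 : ℝ)..t, coeffKernel ρ q (lam k) ξ) := by
    intro t ht k
    rw [bCoeff_eq_integral_coeffKernel]
    exact abs_integral_mul_mem_Icc ht.1.le hε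
      (hg.continuousOn.mono (Set.Icc_subset_Icc_right (ht.2.trans hrT)))
      (intervalIntegrable_coeffKernel q hρ hρ_anti _ ht.1.le)
      (fun s hs => (coeffKernel_pos hρ hρ_anti hq (hlam_pos k).le hs).le) (half_pos h0).le
      fun x hx => hgε x ⟨hx.1, hx.2.trans ht.2⟩
  have hupper : ∀ t ∈ Set.Ioc 0 r, ∀ k, |bCoeff ρ q lam g k t| ≤ 2 * |g 0| / lam k := by
    intro t ht k
    refine (hmem t ht k).2.trans ?_
    rw [le_div_iff₀ (hlam_pos k), mul_assoc, mul_comm _ (lam k)]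
    exact mul_le_of_le_one_right (by positivity)
      (mul_integral_coeffKernel_le_one hρ hρ_anti hq (hlam_pos k).le ht.1)
  have hlower : ∀ t ∈ Set.Ioc 0 r, ∀ k c,
      c ≤ lam k * (∫ ξ in (0 : ℝ)..t, coeffKernel ρ q (lam k) ξ) →
      |g 0| / 2 * c / lam k ≤ |bCoeff ρ q lam g k t| := by
    intro t ht k c hc
    refine le_trans ?_ (hmem t ht k).1
    rw [div_le_iff₀ (hlam_pos k), mul_assoc, mul_comm _ (lam k)]
    exact mul_le_mul_of_nonneg_left hc (by positivity)
  -- The smallest eigenvalue `lam 0` serves as `l₀`, so the estimate holds for every index; it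
  -- yields all claims except the one with `C₀` uniform in `t₀`.
  have hall : ∀ t ∈ Set.Ioc 0 r, ∃ C₀ : ℝ, 0 < C₀ ∧ ∀ k,
      C₀ / lam k ≤ |bCoeff ρ q lam g k t| ∧ |bCoeff ρ q lam g k t| ≤ 2 * |g 0| / lam k := by
    intro t ht
    obtain ⟨c, hc0, hc⟩ :=
      exists_forall_le_mul_integral_coeffKernel hρ hρ_anti hq ht.1 (hlam_pos 0)
    exact ⟨|g 0| / 2 * c, by positivity, fun k =>
      ⟨hlower t ht k c (hc _ (hlam_mono (Nat.zero_le k))), hupper t ht k⟩⟩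
  refine ⟨r, hr0, hrT, 2 * |g 0|, by positivity, ⟨0, fun t ht => ?_⟩,
    ⟨|g 0| / 2 * (1 / 2), by positivity, fun t ht => ?_⟩, fun t ht => ?_, fun t ht => ?_⟩
  · obtain ⟨C₀, hC₀, h⟩ := hall t ht
    exact ⟨C₀, hC₀, fun k _ => h k⟩
  -- The asymptotic bound 1/2 does not depend on `t`; only the index from which it holds does.
  · obtain ⟨k₀, hk₀⟩ := Filter.eventually_atTop.1 (hlam_lim.eventually
      (eventually_half_le_mul_integral_coeffKernel hρ hρ_anti hq ht.1))
    exact ⟨k₀, fun k hk => ⟨hlower t ht k _ (hk₀ k hk), hupper t ht k⟩⟩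
  · obtain ⟨C₀, hC₀, h⟩ := hall t ht
    exact ⟨C₀, hC₀, fun k _ => h k⟩
  · obtain ⟨C₀, hC₀, h⟩ := hall t ht
    have hempty : KZero ρ q lam g t = ∅ := by
      refine Set.eq_empty_of_forall_notMem fun k hk => ?_
      have hk : bCoeff ρ q lam g k t = 0 := hk
      have h1 := (h k).1
      rw [hk, abs_zero] at h1
      exact absurd (div_pos hC₀ (hlam_pos k)) (not_lt.2 h1)
    rw [hempty]
    exact Set.finite_empty
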